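/- Let $m,q,k\ge 1$ be integers and let $\Omega$ be an alphabet with $q$ letters. A cyclic sequence over $\Omega$ is a finite sequence $a_1a_2\ldots a_n$ of letters, considered up to rotation. A $k$-mer is an element of $\Omega^k$; a $k$-mer $y_1\ldots y_k$ occurs in the cyclic sequence $(a_1\ldots a_n)$ at position $i\in\{1,\ldots,n\}$ if $a_{i+j-1}=y_j$ for $j=1,\ldots,k$, with indices of $a$ read modulo $n$ (so occurrences may overlap, may wrap around the end, and may use a position more than once if $k>n$). Let $\mathcal{C}(m,q,k)$ be the set of cyclic sequences over $\Omega$ in which every $k$-mer occurs at exactly $m$ positions. Then $\mathcal{C}(m,q,k)$ is finite and $$|\mathcal{C}(m,q,k)| = \frac{1}{m\,q^k}\sum_{r\mid m}\phi(m/r)\,W(r,q,k),\qquad\text{where}\quad W(r,q,k)=\left(\frac{(rq)!}{r!^{\,q}}\right)^{q^{k-1}},$$ the sum is over the positive divisors $r$ of $m$, and $\phi$ is Euler's totient function. -/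

import Mathlib

namespace MultiDeBruijn

/-- The number of occurrences of the `k`-mer `y` in the linear sequence `s` read cyclically: the
number of starting positions `i < s.length` such that the letters at the positions
`i, i + 1, …, i + k - 1`, taken modulo the length of `s`, spell `y`. Occurrences may overlap, may
wrap around the end, and use positions repeatedly if `k` exceeds the length of `s`. -/
def listOccurrences {Ω : Type*} [DecidableEq Ω] {k : ℕ} (y : Fin k → Ω) (s : List Ω) : ℕ :=
  ((Finset.range s.length).filter
    (fun i => ∀ j : Fin k, s[(i + (j : ℕ)) % s.length]? = some (y j))).card

theorem listOccurrences_le_of_isRotated {Ω : Type*} [DecidableEq Ω] {k : ℕ} (y : Fin k → Ω)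
    {s t : List Ω} (h : s.IsRotated t) : listOccurrences y t ≤ listOccurrences y s := by
  obtain ⟨n, rfl⟩ := h
  unfold listOccurrences
  simp only [List.length_rotate]
  refine Finset.card_le_card_of_injOn (fun i => (i + n) % s.length) ?_ ?_
  · intro i hi
    simp only [Finset.coe_filter, Finset.mem_range, Set.mem_ofPred_eq] at hi ⊢
    obtain ⟨hi, hy⟩ := hi
    have hpos : 0 < s.length := by omega
    refine ⟨Nat.mod_lt _ hpos, fun j => ?_⟩
    have hj := hy j
    rw [List.getElem?_rotate (Nat.mod_lt _ hpos)] at hj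
    rw [← hj]
    congr 1
    rw [Nat.mod_add_mod, Nat.mod_add_mod]
    congr 1
    omega
  · intro a ha b hb hab
    simp only [Finset.coe_filter, Finset.mem_range, Set.mem_ofPred_eq] at ha hb hab
    have h1 : a ≡ b [MOD s.length] := Nat.ModEq.add_right_cancel' n hab
    exact Nat.ModEq.eq_of_lt_of_lt h1 ha.1 hb.1

theorem listOccurrences_eq_of_isRotated {Ω : Type*} [DecidableEq Ω] {k : ℕ} (y : Fin k → Ω)
    {s t : List Ω} (h : s.IsRotated t) : listOccurrences y s = listOccurrences y t :=
  le_antisymm (listOccurrences_le_of_isRotated y h.symm) (listOccurrences_le_of_isRotated y h)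

/-- The number of occurrences of the `k`-mer `y` in a cyclic sequence. A `Cycle Ω` is a linear
sequence up to rotation. -/
def occurrences {Ω : Type*} [DecidableEq Ω] {k : ℕ} (y : Fin k → Ω) (c : Cycle Ω) : ℕ :=
  Quotient.liftOn c (listOccurrences y) (fun _ _ h => listOccurrences_eq_of_isRotated y h)

/-- The set of cyclic multi de Bruijn sequences over the alphabet `Ω`: the cyclic sequences in
which every `k`-mer over `Ω` occurs exactly `m` times. -/
def cyclicMultiDeBruijn (Ω : Type*) [DecidableEq Ω] (m k : ℕ) : Set (Cycle Ω) :=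
  {c | ∀ y : Fin k → Ω, occurrences y c = m}

/-- `W(m, q, k) = ((mq)! / m! ^ q) ^ (q ^ (k - 1))`, used for `k ≥ 1` only. -/
def W (m q k : ℕ) : ℚ :=
  (((m * q).factorial : ℚ) / (m.factorial : ℚ) ^ q) ^ (q ^ (k - 1))

end MultiDeBruijn

namespace MultiDeBruijn

open Polynomial

/-! Write k = K + 1. A sequence of period n = m q^k with every k-mer m times per period is a closed
walk, with a marked start, in the de Bruijn graph on the N = q^K words of length K, using each edge
m times. Such walks are counted in the manner of the BEST theorem. A walk is recovered from its
start r and its exit table, which gives at each vertex the word of letters used to leave it. A table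
whose words all contain each letter m times comes from a closed walk at r if and only if the last
exits lead from every vertex to r (`exists_exitTable_iff`).

That condition sees only the last letters, and the last letter of a balanced word is equidistributed
over the alphabet. With B = (mq)!/m!^q balanced words, the count is therefore (B/q)^N times the
number of pairs of a root and one out-edge per vertex leading to it. That number is q^N
(`card_root_choice`): the matrix-forest theorem reads the rooted trees off the characteristic
polynomial of the adjacency matrix, which is X^(N-1) (X - q) because K shifts forget the starting
vertex. So there are B^N periodic sequences (`ncard_periodicSequences`).

Cyclic sequences are the orbits of these under rotation by ℤ/n, and Burnside's lemma finishes the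
count: a rotation by g with n / gcd(n, g) = e fixes nothing unless e ∣ m, and then fixes exactly the
sequences of period n/e with multiplicity r = m/e. -/

theorem iterate_bind_none {V : Type*} (g : V → Option V) (n : ℕ) :
    (fun o : Option V => o.bind g)^[n] none = none :=
  Function.iterate_fixed rfl n

/-! ### Forests detected by determinants -/

section Forests

variable {V : Type*} [Fintype V] [DecidableEq V]

/-- The adjacency matrix of a partial function `g` on `V`. -/
def partialMatrix (R : Type*) [CommRing R] (g : V → Option V) : Matrix V V R :=
  Matrix.of fun v w => if g v = some w then 1 else 0

/-- A partial function whose iteration is eventually undefined everywhere. -/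
def IsForest (g : V → Option V) : Prop :=
  ∀ v, ∃ n : ℕ, (fun o : Option V => o.bind g)^[n] (some v) = none

theorem partialMatrix_mulVec {R : Type*} [CommRing R] (g : V → Option V) (h : V → R) (v : V) :
    (partialMatrix R g).mulVec h v = (g v).elim 0 h := by
  rcases hg : g v with _ | w <;> simp [partialMatrix, Matrix.mulVec, dotProduct, hg]

theorem partialMatrix_pow_mulVec {R : Type*} [CommRing R] (g : V → Option V) (h : V → R) (n : ℕ)
    (v : V) : ((partialMatrix R g) ^ n).mulVec h v =
      ((fun o : Option V => o.bind g)^[n] (some v)).elim 0 h := by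
  induction n generalizing v with
  | zero => simp
  | succ n ih =>
    rw [pow_succ', ← Matrix.mulVec_mulVec, partialMatrix_mulVec, Function.iterate_succ_apply]
    rcases hg : g v with _ | w
    · simp [hg, iterate_bind_none]
    · simp [hg, ih w]

theorem IsForest.isNilpotent {R : Type*} [CommRing R] {g : V → Option V} (hg : IsForest g) :
    IsNilpotent (partialMatrix R g) := by
  choose n hn using hg
  -- The sum of the escape times bounds each of them, so it serves as a uniform exponent.
  refine ⟨∑ v, n v, ?_⟩
  rw [← Matrix.toLin'.injective.eq_iff]
  ext1 v
  ext w
  obtain ⟨c, hc⟩ := Nat.exists_eq_add_of_le (Finset.single_le_sum (f := n) (fun _ _ => Nat.zero_le _)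
    (Finset.mem_univ w))
  simp only [LinearMap.comp_apply, Matrix.toLin'_apply, partialMatrix_pow_mulVec]
  rw [hc, add_comm, Function.iterate_add_apply, hn, iterate_bind_none]
  simp

/-- Over a domain the characteristic polynomial of a nilpotent matrix is a power of X; the
determinant is its value at 1. -/
theorem det_one_sub_of_isNilpotent {R : Type*} [CommRing R] [IsDomain R] {M : Matrix V V R}
    (hM : IsNilpotent M) : (1 - M).det = 1 := by
  have h := sub_eq_zero.mp (Matrix.isNilpotent_charpoly_sub_pow_of_isNilpotent hM).eq_zero
  have := Matrix.eval_charpoly M 1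
  rw [h] at this
  simpa using this.symm

open Classical in
theorem det_one_sub_partialMatrix {R : Type*} [CommRing R] [IsDomain R] (g : V → Option V) :
    (1 - partialMatrix R g).det = if IsForest g then 1 else 0 := by
  split_ifs with hg
  · exact det_one_sub_of_isNilpotent hg.isNilpotent
  · obtain ⟨v, hv⟩ := not_forall.mp hg
    rw [← Matrix.exists_mulVec_eq_zero_iff]
    -- The indicator of the vertices from which the iteration never stops is a nonzero vector fixed
    -- by the matrix.
    refine ⟨fun w => if ∃ n : ℕ, (fun o : Option V => o.bind g)^[n] (some w) = none then 0 else 1,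
      fun h => ?_, ?_⟩
    · have := congrFun h v
      simp [hv] at this
    · ext w
      rw [Matrix.sub_mulVec, Matrix.one_mulVec, Pi.sub_apply, partialMatrix_mulVec]
      rcases hw : g w with _ | u
      · have : ∃ n : ℕ, (fun o : Option V => o.bind g)^[n] (some w) = none := ⟨1, by simp [hw]⟩
        simp [this]
      · have : (∃ n : ℕ, (fun o : Option V => o.bind g)^[n] (some w) = none) ↔
            ∃ n : ℕ, (fun o : Option V => o.bind g)^[n] (some u) = none := by
          constructor
          · rintro ⟨_ | n, hn⟩
            · simp at hn
            · exact ⟨n, by simpa [hw] using hn⟩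
          · rintro ⟨n, hn⟩
            exact ⟨n + 1, by simpa [hw] using hn⟩
        simp [this]

end Forests

/-! ### The matrix-forest theorem -/

section MatrixForest

variable {V Ω : Type*} [Fintype V] [DecidableEq V] [Fintype Ω]

/-- The adjacency matrix of the digraph with an edge from `v` to `step v a` for each letter `a`. -/
def adjacency (R : Type*) [CommRing R] (step : V → Ω → V) : Matrix V V R :=
  Matrix.of fun v w => ∑ a, if step v a = w then 1 else 0

theorem adjacency_mulVec {R : Type*} [CommRing R] (step : V → Ω → V) (h : V → R) (v : V) :
    (adjacency R step).mulVec h v = ∑ a, h (step v a) := by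
  simp only [adjacency, Matrix.mulVec, dotProduct, Matrix.of_apply, Finset.sum_mul]
  rw [Finset.sum_comm]
  simp

open Classical in
/-- The matrix-forest theorem: the characteristic polynomial of the adjacency matrix of a
`q`-out-regular digraph, evaluated at `q + t`, enumerates the spanning forests by their number of
roots. -/
theorem eval_charpoly_adjacency {R : Type*} [CommRing R] [IsDomain R] (step : V → Ω → V) (t : R) :
    (adjacency R step).charpoly.eval (Fintype.card Ω + t) =
      ∑ o : V → Option Ω, if IsForest (fun v => (o v).map (step v)) then
        t ^ (Finset.univ.filter fun v => o v = none).card else 0 := by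
  rw [Matrix.eval_charpoly]
  -- Each row is a sum over the choices at v: being a root contributes t e_v, and a letter a
  -- contributes e_v - e_(step v a). Multilinearity of the determinant then expands over all partial
  -- choices of out-edges.
  have hrow : Matrix.scalar V ((Fintype.card Ω : R) + t) - adjacency R step =
      fun v => ∑ o : Option Ω, (o.elim t fun _ => 1) •
        (fun w => (1 : Matrix V V R) v w - if o.map (step v) = some w then 1 else 0) := by
    ext v w
    simp only [Matrix.sub_apply, Matrix.scalar_apply, Fintype.sum_option,
      Finset.sum_apply, Pi.smul_apply, adjacency, Matrix.of_apply]
    by_cases hvw : v = w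
    · subst hvw
      simp
      ring
    · simp [hvw]
  rw [hrow]
  have := (Matrix.detRowAlternating (n := V) (R := R)).toMultilinearMap.map_sum
    (fun v (o : Option Ω) => (o.elim t fun _ => 1) •
        (fun w => (1 : Matrix V V R) v w - if o.map (step v) = some w then 1 else 0))
  refine this.trans (Finset.sum_congr rfl fun o _ => ?_)
  rw [MultilinearMap.map_smul_univ]
  have h1 : (∏ v, (o v).elim t fun _ => 1) =
      t ^ (Finset.univ.filter fun v => o v = none).card := by
    rw [← Finset.prod_const, Finset.prod_filter]
    refine Finset.prod_congr rfl fun v _ => ?_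
    rcases o v with _ | a <;> simp
  rw [h1]
  have h2 := det_one_sub_partialMatrix (R := R) (fun v => (o v).map (step v))
  have h3 : (Matrix.detRowAlternating (n := V) (R := R)).toMultilinearMap (fun v w =>
      (1 : Matrix V V R) v w - if (o v).map (step v) = some w then 1 else 0) =
      (1 - partialMatrix R (fun v => (o v).map (step v))).det := rfl
  rw [h3, h2]
  split_ifs <;> simp

end MatrixForest

/-! ### The spectrum of the de Bruijn graph -/

section Shift

variable {Ω : Type*} {K : ℕ}

/-- Drop the first letter of `v` and append the letter `a`. -/
def shift (v : Fin K → Ω) (a : Ω) : Fin K → Ω :=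
  fun j => if h : (j : ℕ) + 1 < K then v ⟨j + 1, h⟩ else a

variable [Fintype Ω] [DecidableEq Ω]

/-- Each shift drops one letter, so i shifts forget the first i letters of the start. For i = K
nothing of the start remains. -/
theorem adjacency_pow_mulVec_congr {R : Type*} [CommRing R] (h : (Fin K → Ω) → R) (i : ℕ)
    (v w : Fin K → Ω) (hvw : ∀ j : Fin K, i ≤ j → v j = w j) :
    ((adjacency R (shift (Ω := Ω) (K := K))) ^ i).mulVec h v =
      ((adjacency R (shift (Ω := Ω) (K := K))) ^ i).mulVec h w := by
  induction i generalizing v w with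
  | zero =>
    have : v = w := funext fun j => hvw j (Nat.zero_le _)
    rw [this]
  | succ i ih =>
    rw [pow_succ', ← Matrix.mulVec_mulVec, adjacency_mulVec, adjacency_mulVec]
    refine Finset.sum_congr rfl fun a _ => ih _ _ fun j hj => ?_
    unfold shift
    split_ifs with h
    · exact hvw _ (by simpa using hj)
    · rfl

/-- The vector with the single non-zero entry `q`, at the vertex `w₀`. -/
def weightAt (R : Type*) [CommRing R] (w₀ : Fin K → Ω) : (Fin K → Ω) → R :=
  Pi.single w₀ (Fintype.card Ω : R)

/-- Both matrices have row sums q, so their difference B kills constants. As B h and A h differ by a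
constant, so do B^K h and A^K h; the latter is constant, whence B^(K+1) = 0. -/
theorem isNilpotent_adjacency_sub {R : Type*} [CommRing R] (w₀ : Fin K → Ω) :
    IsNilpotent (adjacency R (shift (Ω := Ω) (K := K)) -
      Matrix.vecMulVec 1 (weightAt R w₀)) := by
  set A := adjacency R (shift (Ω := Ω) (K := K)) with hA
  set B := A - Matrix.vecMulVec 1 (weightAt R w₀) with hB
  have hBh : ∀ (h : (Fin K → Ω) → R), B.mulVec h =
      A.mulVec h - fun _ => (Fintype.card Ω : R) * h w₀ := by
    intro h
    rw [hB, Matrix.sub_mulVec]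
    congr 1
    ext v
    simp [Matrix.mulVec, Matrix.vecMulVec, dotProduct, weightAt, Pi.single_apply]
  have hBc : ∀ c : R, B.mulVec (fun _ => c) = 0 := by
    intro c
    rw [hBh]
    ext v
    simp [hA, adjacency_mulVec]
  have key : ∀ (h : (Fin K → Ω) → R) (i : ℕ),
      ∃ c : R, (B ^ i).mulVec h = (A ^ i).mulVec h - fun _ => c := by
    intro h i
    induction i with
    | zero => exact ⟨0, by ext; simp⟩
    | succ i ih =>
      obtain ⟨c, hc⟩ := ih
      rw [pow_succ', ← Matrix.mulVec_mulVec, hc, Matrix.mulVec_sub, hBc, sub_zero, hBh, pow_succ',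
        ← Matrix.mulVec_mulVec]
      exact ⟨_, rfl⟩
  refine ⟨K + 1, ?_⟩
  rw [← Matrix.toLin'.injective.eq_iff]
  refine LinearMap.ext fun h => ?_
  obtain ⟨c, hc⟩ := key h K
  rw [Matrix.toLin'_apply, pow_succ', ← Matrix.mulVec_mulVec, hc]
  have hconst : (A ^ K).mulVec h = fun _ => (A ^ K).mulVec h w₀ := by
    ext v
    exact adjacency_pow_mulVec_congr h K v w₀ fun j hj => absurd j.isLt (not_lt.mpr hj)
  rw [hconst, Matrix.mulVec_sub, hBc, hBc]
  simp

/-- Let D be the rank-one matrix removed above. The columns of D are constant, so (A - D) D = 0 and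
(X - (A - D)) (X - D) = X (X - A). Taking determinants reduces the claim to a nilpotent matrix and a
rank-one matrix. -/
theorem charpoly_adjacency_shift {R : Type*} [CommRing R] [IsDomain R] [Nonempty Ω] :
    (adjacency R (shift (Ω := Ω) (K := K))).charpoly =
      X ^ (Fintype.card (Fin K → Ω) - 1) * (X - C (Fintype.card Ω : R)) := by
  obtain ⟨w₀⟩ : Nonempty (Fin K → Ω) := inferInstance
  set A := adjacency R (shift (Ω := Ω) (K := K)) with hA
  set D := Matrix.vecMulVec (1 : (Fin K → Ω) → R) (weightAt R w₀) with hD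
  have hN := isNilpotent_adjacency_sub (R := R) w₀
  rw [← hA, ← hD] at hN
  have hchN : (A - D).charpoly = X ^ Fintype.card (Fin K → Ω) :=
    sub_eq_zero.mp (Matrix.isNilpotent_charpoly_sub_pow_of_isNilpotent hN).eq_zero
  have hmul : (A - D) * D = 0 := by
    have hv : (A - D).mulVec 1 = 0 := by
      ext v
      rw [Matrix.sub_mulVec, Pi.sub_apply, hA, adjacency_mulVec]
      simp [hD, Matrix.mulVec, Matrix.vecMulVec, dotProduct, weightAt]
    rw [hD, Matrix.mul_vecMulVec, ← hD, hv, Matrix.zero_vecMulVec]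
  have hprod : (A - D).charmatrix * D.charmatrix = (X : R[X]) • A.charmatrix := by
    have h0 : (A - D).map C * D.map C = 0 := by
      rw [← Matrix.map_mul, hmul]
      simp
    have h1 : (A - D).map C = A.map C - D.map C := by ext; simp
    have hs : ∀ M : Matrix (Fin K → Ω) (Fin K → Ω) R[X],
        M * Matrix.scalar _ (X : R[X]) = (X : R[X]) • M := by
      intro M; ext v w : 2; simp [Matrix.scalar_apply, mul_comm]
    have hs' : ∀ M : Matrix (Fin K → Ω) (Fin K → Ω) R[X],
        Matrix.scalar _ (X : R[X]) * M = (X : R[X]) • M := by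
      intro M; ext v w : 2; simp [Matrix.scalar_apply]
    simp only [Matrix.charmatrix, RingHom.mapMatrix_apply]
    rw [mul_sub, sub_mul _ _ (D.map C), h0, hs, hs', h1]
    simp only [smul_sub]
    abel
  have hdet := congrArg Matrix.det hprod
  rw [Matrix.det_mul, Matrix.det_smul] at hdet
  change (A - D).charpoly * D.charpoly = _ * A.charpoly at hdet
  rw [hchN] at hdet
  have hX : (X : R[X]) ^ Fintype.card (Fin K → Ω) ≠ 0 := pow_ne_zero _ X_ne_zero
  have := mul_left_cancel₀ hX hdet
  rw [← this, hD, Matrix.charpoly_vecMulVec]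
  have hc : (1 : (Fin K → Ω) → R) ⬝ᵥ weightAt R w₀ = Fintype.card Ω := by
    simp [weightAt]
  have hpos : Fintype.card (Fin K → Ω) = Fintype.card (Fin K → Ω) - 1 + 1 :=
    (Nat.succ_pred_eq_of_pos Fintype.card_pos).symm
  rw [hc, smul_eq_C_mul, mul_sub, ← pow_succ, ← hpos, mul_comm (C _)]

open Classical in
-- Taking t to be an indeterminate, the forest polynomial is (q + t)^(N-1) t; the forests with one
-- root are its coefficient of t.
theorem card_rooted_forests [Nonempty Ω] :
    (Finset.univ.filter fun o : (Fin K → Ω) → Option Ω =>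
      IsForest (fun v => (o v).map (shift v)) ∧
        (Finset.univ.filter fun v => o v = none).card = 1).card =
      Fintype.card Ω ^ (Fintype.card (Fin K → Ω) - 1) := by
  have h := eval_charpoly_adjacency (R := ℤ[X]) (shift (Ω := Ω) (K := K)) X
  rw [charpoly_adjacency_shift] at h
  have h1 := congrArg (fun p => coeff p 1) h
  simp only [eval_mul, eval_pow, eval_sub, eval_X, eval_C, add_sub_cancel_left, coeff_mul_X,
    finsetSum_coeff] at h1
  simp only [coeff_zero_eq_eval_zero, eval_pow, eval_add, eval_natCast, eval_X, add_zero] at h1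
  have h2 : ∀ o : (Fin K → Ω) → Option Ω,
      (if IsForest (fun v => (o v).map (shift v)) then
        (X : ℤ[X]) ^ (Finset.univ.filter fun v => o v = none).card else 0).coeff 1 =
      if IsForest (fun v => (o v).map (shift v)) ∧
        (Finset.univ.filter fun v => o v = none).card = 1 then 1 else 0 := by
    intro o
    by_cases hf : IsForest (fun v => (o v).map (shift v))
    · simp only [hf, if_true, true_and, coeff_X_pow, eq_comm]
    · simp [hf]
  simp only [h2] at h1
  rw [Finset.sum_boole] at h1
  exact_mod_cast h1.symm

end Shift


/-! ### Choices of out-edges leading to a root -/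

section LeadsTo

variable {V : Type*}

/-- Iterating the partial function `g` from a vertex eventually reaches `r`. -/
inductive LeadsTo (g : V → Option V) (r : V) : V → Prop
  | root : LeadsTo g r r
  | step {v w : V} : g v = some w → LeadsTo g r w → LeadsTo g r v

/-- The only dead end of g is r, so running out means arriving at r. The value of h at r is
irrelevant, since `LeadsTo` holds there outright. -/
theorem isForest_iff_leadsTo {g : V → Option V} {r : V} {h : V → V} (hr : g r = none)
    (hg : ∀ v, v ≠ r → g v = some (h v)) :
    IsForest g ↔ ∀ v, LeadsTo (fun w => some (h w)) r v := by
  refine forall_congr' fun v => ⟨?_, fun hv => ?_⟩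
  · rintro ⟨n, hn⟩
    induction n generalizing v with
    | zero => simp at hn
    | succ n ih =>
      by_cases hvr : v = r
      · exact hvr ▸ LeadsTo.root
      · refine LeadsTo.step rfl (ih (h v) ?_)
        simpa [hg v hvr] using hn
  · induction hv with
    | root => exact ⟨1, by simp [hr]⟩
    | @step v w hvw _ ih =>
      by_cases hvr : v = r
      · subst hvr
        exact ⟨1, by simp [hr]⟩
      · obtain ⟨n, hn⟩ := ih
        obtain rfl : h v = w := by simpa using hvw
        exact ⟨n + 1, by simpa [hg v hvr] using hn⟩

theorem LeadsTo.mono {g g' : V → Option V} {r v : V} (hg : ∀ x y, g x = some y → g' x = some y)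
    (h : LeadsTo g r v) : LeadsTo g' r v := by
  induction h with
  | root => exact LeadsTo.root
  | step hxy _ ih => exact LeadsTo.step (hg _ _ hxy) ih

end LeadsTo

open Classical in
/-- The number of pairs of a root `r` and a choice of an outgoing edge at every vertex of the
de Bruijn graph such that the chosen edges lead from everywhere to `r`. -/
theorem card_root_choice (Ω : Type*) [Fintype Ω] [DecidableEq Ω] [Nonempty Ω] (K : ℕ) :
    (Finset.univ.filter fun p : (Fin K → Ω) × ((Fin K → Ω) → Ω) =>
      ∀ v, LeadsTo (fun w => some (shift w (p.2 w))) p.1 v).card =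
      Fintype.card Ω ^ Fintype.card (Fin K → Ω) := by
  have hpos : Fintype.card (Fin K → Ω) = Fintype.card (Fin K → Ω) - 1 + 1 :=
    (Nat.succ_pred_eq_of_pos Fintype.card_pos).symm
  rw [hpos, pow_succ, ← card_rooted_forests, ← Finset.card_univ (α := Ω), ← Finset.card_product]
  have hfor : ∀ (r : Fin K → Ω) (f : (Fin K → Ω) → Ω),
      IsForest (fun v => (Function.update (fun w => some (f w)) r none v).map (shift v)) ↔
        ∀ v, LeadsTo (fun w => some (shift w (f w))) r v := fun r f =>
    isForest_iff_leadsTo (by simp) fun v hv => by simp [hv]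
  -- Erasing the edge at the root leaves a one-root forest; the erased letter is arbitrary and
  -- accounts for the last factor q.
  refine Finset.card_bij (fun p _ => (Function.update (fun w => some (p.2 w)) p.1 none, p.2 p.1))
    ?_ ?_ ?_
  · rintro ⟨r, f⟩ h
    simp only [Finset.mem_filter, Finset.mem_univ, true_and, Finset.mem_product, and_true] at h ⊢
    refine ⟨(hfor r f).mpr h, ?_⟩
    rw [Finset.card_eq_one]
    refine ⟨r, ?_⟩
    ext v
    by_cases hv : v = r
    · simp [hv]
    · simp [hv]
  · rintro ⟨r, f⟩ - ⟨r', f'⟩ - h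
    simp only [Prod.mk.injEq] at h
    have hr : r = r' := by
      by_contra hne
      have := congrFun h.1 r
      simp [hne] at this
    subst hr
    refine Prod.ext rfl (funext fun v => ?_)
    by_cases hv : v = r
    · rw [hv]; exact h.2
    · have := congrFun h.1 v
      simpa [hv] using this
  · rintro ⟨o, a⟩ h
    simp only [Finset.mem_filter, Finset.mem_univ, true_and, Finset.mem_product, and_true] at h
    obtain ⟨hF, hone⟩ := h
    obtain ⟨r, hr⟩ := Finset.card_eq_one.mp hone
    have ho : ∀ v, o v = none ↔ v = r := fun v => by
      have := Finset.ext_iff.mp hr v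
      simpa using this
    have hup : Function.update (fun w => some ((o w).getD a)) r none = o := by
      ext1 v
      by_cases hv : v = r
      · rw [hv, Function.update_self, (ho r).mpr rfl]
      · rw [Function.update_of_ne hv]
        obtain ⟨b, hb⟩ := Option.ne_none_iff_exists'.mp (mt (ho v).mp hv)
        rw [hb]; rfl
    refine ⟨(r, fun v => (o v).getD a), ?_, ?_⟩
    · simp only [Finset.mem_filter, Finset.mem_univ, true_and]
      rw [← hfor, hup]
      exact hF
    · simp only [hup, (ho r).mpr rfl, Option.getD_none]

/-! ### Words with prescribed letter counts -/

section Words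

variable {Ω : Type*} [Fintype Ω] [DecidableEq Ω]

theorem sum_count_eq_length (l : List Ω) : ∑ a, l.count a = l.length := by
  rw [← List.sum_toFinset_count_eq_length l]
  refine (Finset.sum_subset (Finset.subset_univ _) fun a _ ha => ?_).symm
  exact List.count_eq_zero.mpr (by simpa using ha)

theorem finite_wordsWithCounts (c : Ω → ℕ) : {l : List Ω | ∀ a, l.count a = c a}.Finite := by
  refine (List.finite_length_eq Ω (∑ a, c a)).subset fun l hl => ?_
  change l.length = _
  rw [← sum_count_eq_length l]
  exact Finset.sum_congr rfl fun a _ => hl a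

/-- The words with `c a` occurrences of each letter `a`. -/
noncomputable def wordsWithCounts (c : Ω → ℕ) : Finset (List Ω) := (finite_wordsWithCounts c).toFinset

@[simp]
theorem mem_wordsWithCounts {c : Ω → ℕ} {l : List Ω} :
    l ∈ wordsWithCounts c ↔ ∀ a, l.count a = c a := by
  simp [wordsWithCounts]

theorem length_of_mem_wordsWithCounts {c : Ω → ℕ} {l : List Ω} (hl : l ∈ wordsWithCounts c) :
    l.length = ∑ a, c a := by
  rw [← sum_count_eq_length l]
  exact Finset.sum_congr rfl fun a _ => mem_wordsWithCounts.mp hl a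

theorem cons_mem_wordsWithCounts {c : Ω → ℕ} {a : Ω} {l : List Ω} (ha : c a ≠ 0) :
    a :: l ∈ wordsWithCounts c ↔ l ∈ wordsWithCounts (Function.update c a (c a - 1)) := by
  simp only [mem_wordsWithCounts]
  refine forall_congr' fun b => ?_
  by_cases hb : b = a
  · subst hb
    simp
    omega
  · simp [hb, Ne.symm hb]

theorem wordsWithCounts_eq_biUnion {c : Ω → ℕ} (hc : ∑ a, c a ≠ 0) :
    wordsWithCounts c = (Finset.univ.filter fun a => c a ≠ 0).biUnion fun a =>
      (wordsWithCounts (Function.update c a (c a - 1))).image (List.cons a) := by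
  ext l
  simp only [Finset.mem_biUnion, Finset.mem_filter, Finset.mem_univ, true_and, Finset.mem_image]
  constructor
  · intro hl
    rcases l with _ | ⟨a, l⟩
    · exact absurd (length_of_mem_wordsWithCounts hl).symm hc
    · have ha : c a ≠ 0 := by
        rw [← mem_wordsWithCounts.mp hl a]
        simp
      exact ⟨a, ha, l, (cons_mem_wordsWithCounts ha).mp hl, rfl⟩
  · rintro ⟨a, ha, l, hl, rfl⟩
    exact (cons_mem_wordsWithCounts ha).mpr hl

/-- Splitting off the first letter gives the recursion of the multinomial coefficients. -/
theorem card_wordsWithCounts (c : Ω → ℕ) :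
    (wordsWithCounts c).card * ∏ a, (c a).factorial = (∑ a, c a).factorial := by
  induction hn : ∑ a, c a generalizing c with
  | zero =>
    have hc : ∀ a, c a = 0 := by simpa using hn
    have : wordsWithCounts c = {[]} := by
      ext l
      constructor
      · intro hl
        simpa using (length_of_mem_wordsWithCounts hl).trans hn
      · intro hl
        rw [Finset.mem_singleton] at hl
        simp [hl, hc]
    simp [this, hc]
  | succ n ih =>
    rw [wordsWithCounts_eq_biUnion (by omega), Finset.card_biUnion, Finset.sum_mul]
    · rw [Nat.factorial_succ, ← hn, Finset.sum_mul,
        ← Finset.sum_filter_of_ne (p := fun a => c a ≠ 0)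
          (f := fun a => c a * n.factorial) fun a _ h => left_ne_zero_of_mul h]
      refine Finset.sum_congr rfl fun a ha => ?_
      have ha : c a ≠ 0 := (Finset.mem_filter.mp ha).2
      rw [Finset.card_image_of_injective _ (List.cons_injective)]
      have hsum : ∑ b, Function.update c a (c a - 1) b = n := by
        have h1 := Finset.add_sum_erase Finset.univ c (Finset.mem_univ a)
        have h2 := Finset.add_sum_erase Finset.univ (Function.update c a (c a - 1))
          (Finset.mem_univ a)
        have h3 : ∑ b ∈ Finset.univ.erase a, Function.update c a (c a - 1) b =
            ∑ b ∈ Finset.univ.erase a, c b :=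
          Finset.sum_congr rfl fun b hb => by simp [Finset.ne_of_mem_erase hb]
        rw [Function.update_self] at h2
        omega
      rw [← ih _ hsum]
      have h1 := Finset.mul_prod_erase Finset.univ (fun b => (c b).factorial) (Finset.mem_univ a)
      have h2 := Finset.mul_prod_erase Finset.univ
        (fun b => (Function.update c a (c a - 1) b).factorial) (Finset.mem_univ a)
      have h3 : ∏ b ∈ Finset.univ.erase a, (Function.update c a (c a - 1) b).factorial =
          ∏ b ∈ Finset.univ.erase a, (c b).factorial :=
        Finset.prod_congr rfl fun b hb => by simp [Finset.ne_of_mem_erase hb]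
      rw [h3, Function.update_self] at h2
      rw [← h1, ← h2, ← Nat.mul_factorial_pred ha]
      ring
    · intro a _ b _ hab
      rw [Function.onFun, Finset.disjoint_left]
      intro l hl hl'
      obtain ⟨l₁, -, rfl⟩ := Finset.mem_image.mp hl
      obtain ⟨l₂, -, h⟩ := Finset.mem_image.mp hl'
      exact hab (List.cons.inj h).1.symm

/-- The words with `m` occurrences of each letter and with last letter `a`. -/
noncomputable def balancedWordsEndingIn (m : ℕ) (a : Ω) : Finset (List Ω) :=
  (wordsWithCounts fun _ : Ω => m).filter fun l => l.getLast? = some a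

/-- Swapping two letters of the alphabet preserves balance and exchanges the last letters. -/
theorem card_balancedWordsEndingIn_le (m : ℕ) (a b : Ω) :
    (balancedWordsEndingIn m a).card ≤ (balancedWordsEndingIn m b).card := by
  refine Finset.card_le_card_of_injOn (List.map (Equiv.swap a b)) ?_
    (List.map_injective_iff.mpr (Equiv.injective _)).injOn
  intro l hl
  simp only [balancedWordsEndingIn, Finset.coe_filter, mem_wordsWithCounts,
    Set.mem_ofPred_eq] at hl ⊢
  refine ⟨fun x => ?_, by simp [hl.2]⟩
  rw [← hl.1 (Equiv.swap a b x)]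
  conv_lhs => rw [← Equiv.swap_apply_self a b x]
  exact List.count_map_of_injective _ _ (Equiv.injective _) _

theorem card_balancedWords [Nonempty Ω] {m : ℕ} (hm : 1 ≤ m) (a : Ω) :
    (wordsWithCounts fun _ : Ω => m).card =
      Fintype.card Ω * (balancedWordsEndingIn m a).card := by
  have h : (wordsWithCounts fun _ : Ω => m) =
      Finset.univ.biUnion fun b => balancedWordsEndingIn m b := by
    ext l
    simp only [balancedWordsEndingIn, Finset.mem_biUnion, Finset.mem_univ, true_and,
      Finset.mem_filter, exists_and_left]
    refine ⟨fun hl => ⟨hl, ?_⟩, fun hl => hl.1⟩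
    have hne : l ≠ [] := by
      rintro rfl
      have := mem_wordsWithCounts.mp hl a
      simp at this
      omega
    exact ⟨l.getLast hne, List.getLast?_eq_some_getLast hne⟩
  rw [h, Finset.card_biUnion, Finset.sum_congr rfl fun b _ =>
    le_antisymm (card_balancedWordsEndingIn_le m b a) (card_balancedWordsEndingIn_le m a b)]
  · simp
  · intro b _ b' _ hb
    rw [Function.onFun, Finset.disjoint_left]
    intro l hl hl'
    have h1 := (Finset.mem_filter.mp hl).2
    rw [(Finset.mem_filter.mp hl').2] at h1
    exact hb (Option.some.inj h1).symm

end Words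


/-! ### Exit tables and the BEST correspondence -/

section Tables

variable {V Ω : Type*} [DecidableEq V]

/-- The exit table of the walk from `u` along the letters of `s`: it lists, for every vertex, the
letters by which the walk leaves that vertex. -/
def exitTable (step : V → Ω → V) : V → List Ω → V → List Ω
  | _, [] => fun _ => []
  | u, a :: s =>
    Function.update (exitTable step (step u a) s) u (a :: exitTable step (step u a) s u)

/-- The walk can be replayed: the next letter is always the first unused entry at the current
vertex. -/
theorem exitTable_injective (step : V → Ω → V) (u : V) :
    Function.Injective (exitTable step u) := by
  intro s
  induction s generalizing u with
  | nil =>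
    rintro (_ | ⟨b, t⟩) h
    · rfl
    · have := congrFun h u
      simp [exitTable] at this
  | cons a s ih =>
    rintro (_ | ⟨b, t⟩) h
    · have := congrFun h u
      simp [exitTable] at this
    · have hu := congrFun h u
      simp only [exitTable, Function.update_self, List.cons.injEq] at hu
      obtain ⟨rfl, hu⟩ := hu
      rw [ih (step u a) (a₂ := t) (funext fun w => ?_)]
      by_cases hw : w = u
      · rw [hw, hu]
      · have := congrFun h w
        simpa [exitTable, hw] using this

theorem exists_exitTable_cons {step : V → Ω → V} {u : V} {T : V → List Ω} {a : Ω} {l : List Ω}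
    (hT : T u = a :: l) :
    (∃ s, exitTable step u s = T) ↔
      ∃ s, exitTable step (step u a) s = Function.update T u l := by
  constructor
  · rintro ⟨_ | ⟨b, s⟩, rfl⟩
    · simp [exitTable] at hT
    · simp only [exitTable, Function.update_self, List.cons.injEq] at hT
      obtain ⟨rfl, hl⟩ := hT
      exact ⟨s, by simp [exitTable, ← hl]⟩
  · rintro ⟨s, hs⟩
    exact ⟨a :: s, by simp [exitTable, hs, ← hT]⟩

/-- The edge by which a walk with exit table `T` leaves a vertex for the last time. -/
def lastExit (step : V → Ω → V) (T : V → List Ω) (v : V) : Option V :=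
  (T v).getLast?.map (step v)

variable [Fintype V]

/-- The number of entries of the table `T` that lead to `w`. -/
def inDegree (step : V → Ω → V) (T : V → List Ω) (w : V) : ℕ :=
  ∑ v, (T v).countP fun a => step v a = w

/-- The degree condition for a walk from `u` to `v` with exit table `T`. -/
def IsBalanced (step : V → Ω → V) (T : V → List Ω) (u v : V) : Prop :=
  ∀ w, inDegree step T w + (if w = u then 1 else 0) = (T w).length + (if w = v then 1 else 0)

theorem inDegree_update {step : V → Ω → V} {u : V} {T : V → List Ω} {a : Ω} {l : List Ω}
    (hT : T u = a :: l) (w : V) :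
    inDegree step T w =
      inDegree step (Function.update T u l) w + if w = step u a then 1 else 0 := by
  unfold inDegree
  rw [← Finset.add_sum_erase _ _ (Finset.mem_univ u),
    ← Finset.add_sum_erase _ (fun v => (Function.update T u l v).countP _) (Finset.mem_univ u),
    Finset.sum_congr rfl fun v hv => by
      rw [← Function.update_of_ne (Finset.ne_of_mem_erase hv) l T]]
  rw [hT, Function.update_self, List.countP_cons]
  simp only [decide_eq_true_eq, eq_comm (a := w)]
  omega

/-- Using up the first exit of u amounts to moving the start of the walk to `step u a`. -/
theorem isBalanced_update_iff {step : V → Ω → V} {u v : V} {T : V → List Ω} {a : Ω} {l : List Ω}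
    (hT : T u = a :: l) :
    IsBalanced step T u v ↔ IsBalanced step (Function.update T u l) (step u a) v := by
  refine forall_congr' fun w => ?_
  rw [inDegree_update hT]
  by_cases hw : w = u
  · subst hw
    simp only [hT, Function.update_self, List.length_cons, if_true]
    omega
  · simp [hw]

theorem isBalanced_exitTable (step : V → Ω → V) (u : V) (s : List Ω) :
    IsBalanced step (exitTable step u s) u (s.foldl step u) := by
  induction s generalizing u with
  | nil => intro w; simp [exitTable, inDegree]; rfl
  | cons a s ih =>
    rw [isBalanced_update_iff (a := a) (l := exitTable step (step u a) s u) (by simp [exitTable])]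
    simpa [exitTable] using ih (step u a)

theorem inDegree_pos {step : V → Ω → V} {T : V → List Ω} {v w : V}
    (h : lastExit step T v = some w) : 0 < inDegree step T w := by
  obtain ⟨a, ha, rfl⟩ := Option.map_eq_some_iff.mp h
  refine Finset.sum_pos' (fun _ _ => Nat.zero_le _) ⟨v, Finset.mem_univ v, ?_⟩
  exact List.countP_pos_iff.mpr ⟨a, List.mem_of_getLast? ha, by simp⟩

/-- All vertices with an exit lead to `r` along the last exits. -/
def LastExitsLeadTo (step : V → Ω → V) (T : V → List Ω) (r : V) : Prop :=
  ∀ w, T w ≠ [] → LeadsTo (lastExit step T) r w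

/-- This is the induction step of the BEST correspondence. If u keeps an entry, no last exit
changes. If its list runs out, balance shows that no remaining entry enters u unless u = r, so no
other vertex relied on the lost exit. -/
theorem lastExitsLeadTo_update_iff {step : V → Ω → V} {u r : V} {T : V → List Ω} {a : Ω}
    {l : List Ω} (hT : T u = a :: l) (hb : IsBalanced step T u r) :
    LastExitsLeadTo step T r ↔ LastExitsLeadTo step (Function.update T u l) r := by
  have hb' := (isBalanced_update_iff hT).mp hb
  have hne : ∀ w, w ≠ u → Function.update T u l w = T w :=
    fun w hw => Function.update_of_ne hw l T
  rcases l.eq_nil_or_concat with rfl | ⟨l', b, rfl⟩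
  · have hlast : ∀ w, w ≠ u → lastExit step (Function.update T u []) w = lastExit step T w :=
      fun w hw => by simp [lastExit, hne w hw]
    have hlastu : lastExit step T u = some (step u a) := by simp [lastExit, hT]
    constructor
    · intro h
      have key : ∀ w, LeadsTo (lastExit step T) r w →
          (w = u ∧ u ≠ r) ∨ LeadsTo (lastExit step (Function.update T u [])) r w := by
        intro w hw
        induction hw with
        | root => exact Or.inr LeadsTo.root
        | @step x y hxy _ ih =>
          by_cases hx : x = u
          · by_cases hur : u = r
            · exact Or.inr (hx.trans hur ▸ LeadsTo.root)
            · exact Or.inl ⟨hx, hur⟩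
          · rw [← hlast x hx] at hxy
            -- An arrow from x into the exhausted vertex, which is not r, contradicts its in-degree
            -- being 0.
            rcases ih with ⟨rfl, hyr⟩ | ih
            · have h1 := hb' y
              have h2 := inDegree_pos hxy
              simp only [Function.update_self, List.length_nil, if_neg hyr] at h1
              omega
            · exact Or.inr (LeadsTo.step hxy ih)
      intro w hw
      have hwu : w ≠ u := by
        rintro rfl
        simp at hw
      rw [hne w hwu] at hw
      exact (key w (h w hw)).resolve_left fun h' => hwu h'.1
    · intro h
      have hmono : ∀ w, LeadsTo (lastExit step (Function.update T u [])) r w →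
          LeadsTo (lastExit step T) r w := fun w => LeadsTo.mono fun x y hxy => by
        by_cases hx : x = u
        · subst hx
          simp [lastExit] at hxy
        · rw [← hlast x hx, hxy]
      intro w hw
      by_cases hwu : w = u
      · subst hwu
        refine LeadsTo.step hlastu ?_
        by_cases hr : step w a = r
        · exact hr ▸ LeadsTo.root
        -- The remaining walk starts at `step w a`; away from r, balance forces that vertex to have
        -- an exit.
        · refine hmono _ (h _ fun h0 => ?_)
          have h1 := hb' (step w a)
          simp [h0, hr] at h1
      · exact hmono w (h w (by rwa [hne w hwu]))
  · have hlast : lastExit step (Function.update T u (l'.concat b)) = lastExit step T := by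
      ext1 w
      by_cases hw : w = u
      · subst hw
        simp [lastExit, hT, List.getLast?_cons]
      · simp [lastExit, hw]
    unfold LastExitsLeadTo
    rw [hlast]
    refine forall_congr' fun w => ?_
    by_cases hw : w = u
    · subst hw
      simp [hT]
    · simp [hw]

/-- A table with the degrees of a walk from `u` to `r` is an exit table if and only if the last
exits form a tree towards `r`. -/
theorem exists_exitTable_iff {step : V → Ω → V} {u r : V} {T : V → List Ω}
    (hb : IsBalanced step T u r) :
    (∃ s, exitTable step u s = T) ↔ LastExitsLeadTo step T r := by
  induction hn : ∑ v, (T v).length using Nat.strong_induction_on generalizing T u with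
  | _ n ih =>
  rcases hT : T u with _ | ⟨a, l⟩
  -- A walk with no exit at u must end there, so u = r has in-degree 0. Then only r leads to r, and
  -- the condition says that the table is empty.
  · have hu := hb u
    have hur : u = r := by
      by_contra hne
      simp [hT, hne] at hu
    subst hur
    have hin : inDegree step T u = 0 := by simpa [hT] using hu
    have hroot : ∀ w, LeadsTo (lastExit step T) u w → w = u := by
      intro w hw
      induction hw with
      | root => rfl
      | step hxy _ ih =>
        subst ih
        exact absurd (inDegree_pos hxy) (by omega)
    constructor
    · rintro ⟨_ | ⟨a, s⟩, rfl⟩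
      · intro w hw
        simp [exitTable] at hw
      · simp [exitTable] at hT
    · intro h
      refine ⟨[], funext fun w => ?_⟩
      by_contra hw
      have hw' : T w ≠ [] := fun h0 => hw (by simp [exitTable, h0])
      exact hw' (by rw [hroot w (h w hw'), hT])
  · rw [exists_exitTable_cons hT, lastExitsLeadTo_update_iff hT hb]
    refine ih _ ?_ ((isBalanced_update_iff hT).mp hb) rfl
    rw [← hn]
    refine Finset.sum_lt_sum (fun v _ => ?_) ⟨u, Finset.mem_univ u, by simp [hT]⟩
    by_cases hv : v = u
    · subst hv
      simp [hT]
    · simp [hv]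

theorem sum_length_exitTable (step : V → Ω → V) (u : V)
    (s : List Ω) : ∑ v, (exitTable step u s v).length = s.length := by
  induction s generalizing u with
  | nil => simp [exitTable]
  | cons a s ih =>
    rw [List.length_cons, ← ih (step u a), exitTable, ← Finset.add_sum_erase _ _ (Finset.mem_univ u),
      ← Finset.add_sum_erase _ (fun v => (exitTable step (step u a) s v).length)
        (Finset.mem_univ u), Finset.sum_congr rfl fun v hv => by
      rw [Function.update_of_ne (Finset.ne_of_mem_erase hv)]]
    simp
    omega

end Tables

/-! ### Walks along infinite letter sequences -/

section Walks

variable {V Ω : Type*}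

/-- The position after `i` steps of the walk from `u` along the letters of `x`. -/
def walk (step : V → Ω → V) (u : V) (x : ℕ → Ω) : ℕ → V
  | 0 => u
  | i + 1 => step (walk step u x i) (x i)

theorem walk_succ' (step : V → Ω → V) (u : V) (x : ℕ → Ω) (i : ℕ) :
    walk step u x (i + 1) = walk step (step u (x 0)) (fun j => x (j + 1)) i := by
  induction i with
  | zero => rfl
  | succ i ih => rw [walk, ih, walk]

theorem walk_eq_foldl (step : V → Ω → V) (u : V) (x : ℕ → Ω) (n : ℕ) :
    ((List.range n).map x).foldl step u = walk step u x n := by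
  induction n with
  | zero => rfl
  | succ n ih => simp [List.range_succ, ih, walk]

theorem walk_add_of_periodic {step : V → Ω → V} {u : V} {x : ℕ → Ω} {n : ℕ}
    (hx : Function.Periodic x n) (hu : walk step u x n = u) :
    Function.Periodic (walk step u x) n := by
  intro i
  induction i with
  | zero => simpa [walk] using hu
  | succ i ih => rw [Nat.add_right_comm, walk, walk, ih, hx]

theorem count_exitTable [DecidableEq V] [DecidableEq Ω] (step : V → Ω → V) (u : V) (x : ℕ → Ω)
    (n : ℕ) (v : V) (a : Ω) :
    (exitTable step u ((List.range n).map x) v).count a =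
      Nat.count (fun i => walk step u x i = v ∧ x i = a) n := by
  induction n generalizing u x with
  | zero => simp [exitTable]
  | succ n ih =>
    rw [List.range_succ_eq_map, List.map_cons, List.map_map, Nat.count_succ', exitTable]
    have h := ih (step u (x 0)) (fun j => x (j + 1))
    simp only [walk_succ', ← h]
    change List.count a (Function.update (exitTable step (step u (x 0))
      ((List.range n).map fun j => x (j + 1))) u (x 0 :: exitTable step (step u (x 0))
      ((List.range n).map fun j => x (j + 1)) u) v) = _
    by_cases hv : v = u
    · subst hv
      simp [walk, List.count_cons]
    · simp [hv, walk, Ne.symm hv]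

end Walks


/-! ### Uniform tables on the de Bruijn graph -/

section Shift

variable {Ω : Type*} {K : ℕ}

theorem shift_eq_snoc_succ (v : Fin K → Ω) (a : Ω) (j : Fin K) :
    shift v a j = Fin.snoc (α := fun _ => Ω) v a j.succ := by
  simp [shift, Fin.snoc]
  rfl

theorem walk_shift_apply (u : Fin K → Ω) (x : ℕ → Ω) (i : ℕ) (j : Fin K) :
    walk shift u x i j = if h : i + j < K then u ⟨i + j, h⟩ else x (i + j - K) := by
  induction i generalizing j with
  | zero => simp [walk]
  | succ i ih =>
    rw [walk, shift]
    split_ifs with h1 h2 h2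
    · rw [ih]
      have : i + ((j : ℕ) + 1) < K := by omega
      simp only [this, dif_pos]
      congr 2
      omega
    · rw [ih]
      have : ¬ i + ((j : ℕ) + 1) < K := by omega
      simp only [this, dif_neg, not_false_eq_true]
      congr 1
      omega
    · omega
    · congr 1
      have := j.isLt
      omega

theorem walk_shift_window (b : ℕ → Ω) (i : ℕ) :
    walk shift (fun j : Fin K => b j) (fun i => b (i + K)) i = fun j : Fin K => b (i + j) := by
  ext1 j
  rw [walk_shift_apply]
  split_ifs with h
  · rfl
  · congr 1
    omega

variable [Fintype Ω] [DecidableEq Ω]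

/-- The pair (v, a), read as a word of length K + 1, has tail w and a free first letter. This
reading also covers K = 0, where the single vertex carries q loops. -/
theorem card_shift_eq (w : Fin K → Ω) :
    (Finset.univ.filter fun p : (Fin K → Ω) × Ω => shift p.1 p.2 = w).card = Fintype.card Ω := by
  rw [← Finset.card_univ (α := Ω)]
  symm
  refine Finset.card_bij (fun c _ => (Fin.init (Fin.cons (α := fun _ => Ω) c w),
    Fin.cons (α := fun _ => Ω) c w (Fin.last K))) ?_ ?_ ?_
  · intro c _
    simp only [Finset.mem_filter, Finset.mem_univ, true_and]
    ext1 j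
    rw [shift_eq_snoc_succ, Fin.snoc_init_self, Fin.cons_succ]
  · intro c _ c' _ h
    simp only [Prod.mk.injEq] at h
    have := Fin.snoc_init_self (α := fun _ => Ω) (Fin.cons (α := fun _ => Ω) c w)
    rw [h.1, h.2, Fin.snoc_init_self] at this
    simpa using (congrFun this 0).symm
  · rintro ⟨v, a⟩ h
    simp only [Finset.mem_filter, Finset.mem_univ, true_and] at h
    refine ⟨Fin.snoc (α := fun _ => Ω) v a 0, Finset.mem_univ _, ?_⟩
    have : Fin.cons (α := fun _ => Ω) (Fin.snoc (α := fun _ => Ω) v a 0) w =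
        Fin.snoc (α := fun _ => Ω) v a := by
      refine funext (Fin.cases ?_ fun j => ?_)
      · simp
      · rw [Fin.cons_succ, ← h, shift_eq_snoc_succ]
    simp [this]

/-- The tables in which each letter occurs `m` times at each vertex. -/
def IsUniform (m : ℕ) (T : (Fin K → Ω) → List Ω) : Prop := ∀ v a, (T v).count a = m

omit [Fintype Ω] in
theorem IsUniform.ne_nil [Nonempty Ω] {m : ℕ} (hm : 1 ≤ m) {T : (Fin K → Ω) → List Ω}
    (hT : IsUniform m T) (v : Fin K → Ω) : T v ≠ [] := by
  intro h
  obtain ⟨a⟩ : Nonempty Ω := inferInstance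
  have := hT v a
  simp [h] at this
  omega

theorem IsUniform.length {m : ℕ} {T : (Fin K → Ω) → List Ω} (hT : IsUniform m T)
    (v : Fin K → Ω) : (T v).length = Fintype.card Ω * m := by
  rw [← sum_count_eq_length, Finset.sum_congr rfl fun a _ => hT v a]
  simp

theorem countP_eq_sum_count (p : Ω → Prop) [DecidablePred p] (l : List Ω) :
    l.countP (fun a => p a) = ∑ a, if p a then l.count a else 0 := by
  induction l with
  | nil => simp
  | cons b l ih =>
    rw [List.countP_cons, ih]
    have : ∀ a, (if p a then (b :: l).count a else 0) =
        (if p a then l.count a else 0) + if b = a then (if p b then 1 else 0) else 0 := by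
      intro a
      by_cases hb : b = a
      · subst hb
        by_cases hp : p b <;> simp [hp]
      · simp [hb]
    rw [Finset.sum_congr rfl fun a _ => this a, Finset.sum_add_distrib]
    simp

theorem IsUniform.inDegree {m : ℕ} {T : (Fin K → Ω) → List Ω} (hT : IsUniform m T)
    (w : Fin K → Ω) : inDegree shift T w = Fintype.card Ω * m := by
  unfold MultiDeBruijn.inDegree
  rw [← card_shift_eq w, Finset.card_filter, Finset.sum_mul, Fintype.sum_prod_type]
  refine Finset.sum_congr rfl fun v _ => ?_
  rw [countP_eq_sum_count]
  refine Finset.sum_congr rfl fun a _ => ?_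
  rw [hT v a]
  simp

/-- In-degrees and out-degrees all equal q m, so every vertex can serve as the start of a closed
walk. -/
theorem IsUniform.isBalanced {m : ℕ} {T : (Fin K → Ω) → List Ω} (hT : IsUniform m T)
    (r : Fin K → Ω) : IsBalanced shift T r r := fun w => by rw [hT.inDegree, hT.length]

omit [Fintype Ω] in
theorem IsUniform.lastExitsLeadTo_iff [Nonempty Ω] {m : ℕ} (hm : 1 ≤ m)
    {T : (Fin K → Ω) → List Ω} (hT : IsUniform m T) {f : (Fin K → Ω) → Ω}
    (hf : ∀ v, (T v).getLast? = some (f v)) (r : Fin K → Ω) :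
    LastExitsLeadTo shift T r ↔ ∀ v, LeadsTo (fun w => some (shift w (f w))) r v := by
  have : lastExit shift T = fun w => some (shift w (f w)) := by
    ext1 w
    simp [lastExit, hf]
  unfold LastExitsLeadTo
  rw [this]
  exact forall_congr' fun v => ⟨fun h => h (hT.ne_nil hm v), fun h _ => h⟩

open Classical in
/-- The pairs of a root and a uniform table whose last exits lead to the root. -/
noncomputable def rootedTables (Ω : Type*) [Fintype Ω] [DecidableEq Ω] (K m : ℕ) :
    Finset ((Fin K → Ω) × ((Fin K → Ω) → List Ω)) :=
  (Finset.univ ×ˢ Fintype.piFinset fun _ => wordsWithCounts fun _ : Ω => m).filter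
    fun p => LastExitsLeadTo shift p.2 p.1

theorem mem_rootedTables {m : ℕ} {p : (Fin K → Ω) × ((Fin K → Ω) → List Ω)} :
    p ∈ rootedTables Ω K m ↔ IsUniform m p.2 ∧ LastExitsLeadTo shift p.2 p.1 := by
  simp [rootedTables, IsUniform]

open Classical in
-- Fibre over the root and the last letters. All fibres over admissible choices have the same size
-- E^N, where E is the number of balanced words with a given last letter. There are q^N such
-- choices, and q E is the number of balanced words.
theorem card_rootedTables [Nonempty Ω] {m : ℕ} (hm : 1 ≤ m) :
    (rootedTables Ω K m).card =
      (wordsWithCounts fun _ : Ω => m).card ^ Fintype.card (Fin K → Ω) := by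
  obtain ⟨a₀⟩ : Nonempty Ω := inferInstance
  set S := Finset.univ.filter fun p : (Fin K → Ω) × ((Fin K → Ω) → Ω) =>
      ∀ v, LeadsTo (fun w => some (shift w (p.2 w))) p.1 v with hS
  have hlast : ∀ (T : (Fin K → Ω) → List Ω), IsUniform m T →
      ∀ v, (T v).getLast? = some ((T v).getLastD a₀) := fun T hT v => by
    rw [List.getLastD_eq_getLast?, List.getLast?_eq_some_getLast (hT.ne_nil hm v)]
    rfl
  have hmaps : ∀ p ∈ rootedTables Ω K m, (p.1, fun v => (p.2 v).getLastD a₀) ∈ S := by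
    intro p hp
    obtain ⟨h1, h2⟩ := mem_rootedTables.mp hp
    exact Finset.mem_filter.mpr ⟨Finset.mem_univ _,
      (h1.lastExitsLeadTo_iff hm (hlast _ h1) _).mp h2⟩
  rw [Finset.card_eq_sum_card_fiberwise hmaps]
  have hfib : ∀ p ∈ S, ((rootedTables Ω K m).filter fun x =>
      (x.1, fun v => (x.2 v).getLastD a₀) = p).card =
      (balancedWordsEndingIn m a₀).card ^ Fintype.card (Fin K → Ω) := by
    rintro ⟨r, f⟩ hp
    have hp := (Finset.mem_filter.mp hp).2
    have : (rootedTables Ω K m).filter (fun x => (x.1, fun v => (x.2 v).getLastD a₀) = (r, f)) =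
        {r} ×ˢ Fintype.piFinset fun v => balancedWordsEndingIn m (f v) := by
      ext ⟨r', T⟩
      simp only [Finset.mem_filter, mem_rootedTables, Finset.mem_product, Finset.mem_singleton,
        Fintype.mem_piFinset, Prod.mk.injEq, balancedWordsEndingIn, mem_wordsWithCounts]
      constructor
      · rintro ⟨⟨h1, -⟩, rfl, rfl⟩
        exact ⟨rfl, fun v => ⟨h1 v, hlast T h1 v⟩⟩
      · rintro ⟨rfl, h⟩
        have hT : IsUniform m T := fun v => (h v).1
        refine ⟨⟨hT, (hT.lastExitsLeadTo_iff hm (fun v => (h v).2) _).mpr hp⟩, rfl, ?_⟩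
        ext1 v
        rw [List.getLastD_eq_getLast?, (h v).2]
        rfl
    rw [this, Finset.card_product, Finset.card_singleton, one_mul, Fintype.card_piFinset,
      Finset.prod_congr rfl fun v _ => le_antisymm (card_balancedWordsEndingIn_le m (f v) a₀)
        (card_balancedWordsEndingIn_le m a₀ (f v))]
    simp
  rw [Finset.sum_congr rfl hfib, Finset.sum_const, hS, card_root_choice, smul_eq_mul, ← mul_pow,
    ← card_balancedWords hm]

end Shift

/-! ### Periodic sequences as rooted tables -/

section PeriodicSequences

variable {Ω : Type*} [DecidableEq Ω]

/-- The `n`-periodic sequences in which every `k`-mer occurs at `m` positions of a period. -/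
def periodicSequences (Ω : Type*) [DecidableEq Ω] (n k m : ℕ) : Set (ℕ → Ω) :=
  {b | Function.Periodic b n ∧
    ∀ y : Fin k → Ω, Nat.count (fun i => ∀ j : Fin k, b (i + j) = y j) n = m}

theorem finite_periodicSequences [Finite Ω] {n : ℕ} (hn : 0 < n) (k m : ℕ) :
    (periodicSequences Ω n k m).Finite := by
  refine Set.Finite.of_finite_image (f := fun b (i : Fin n) => b i) (Set.toFinite _) ?_
  intro b hb b' hb' h
  ext i
  rw [← hb.1.map_mod_nat, ← hb'.1.map_mod_nat]
  exact congrFun h ⟨i % n, Nat.mod_lt _ hn⟩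

/-- A (K+1)-mer is a vertex v followed by a letter a; its occurrences are the times at which the
walk leaves v by a. -/
theorem mem_periodicSequences_iff_isUniform {n K m : ℕ} {b : ℕ → Ω} :
    b ∈ periodicSequences Ω n (K + 1) m ↔ Function.Periodic b n ∧
      IsUniform m (exitTable shift (fun j : Fin K => b j)
        ((List.range n).map fun i => b (i + K))) := by
  refine and_congr_right fun _ => ?_
  unfold IsUniform
  simp only [count_exitTable, walk_shift_window]
  have key : ∀ (v : Fin K → Ω) (a : Ω),
      Nat.count (fun i => (fun j : Fin K => b (i + j)) = v ∧ b (i + K) = a) n =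
      Nat.count (fun i => ∀ j : Fin (K + 1), b (i + j) = Fin.snoc (α := fun _ => Ω) v a j) n := by
    intro v a
    congr 1
    ext i
    rw [Fin.forall_fin_succ']
    simp [funext_iff]
  constructor
  · intro h v a
    rw [key]
    exact h _
  · intro h y
    have := h (Fin.init y) (y (Fin.last K))
    rwa [key, Fin.snoc_init_self] at this

variable [Fintype Ω]

theorem ncard_periodicSequences [Nonempty Ω] {K m : ℕ} (hm : 1 ≤ m) :
    (periodicSequences Ω (m * Fintype.card Ω ^ (K + 1)) (K + 1) m).ncard =
      (wordsWithCounts fun _ : Ω => m).card ^ Fintype.card Ω ^ K := by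
  have hcard : Fintype.card (Fin K → Ω) = Fintype.card Ω ^ K := by simp
  rw [← hcard, ← card_rootedTables hm, ← Set.ncard_coe_finset]
  set n := m * Fintype.card Ω ^ (K + 1) with hn
  have hn0 : 0 < n := Nat.mul_pos hm (pow_pos Fintype.card_pos _)
  -- Table letters are read from position K on. Undoing this offset on natural indices uses K n - K
  -- ≥ 0, which is -K modulo the period; K itself may exceed n.
  have hKn : K ≤ K * n := Nat.le_mul_of_pos_right K hn0
  set Φ : (ℕ → Ω) → (Fin K → Ω) × ((Fin K → Ω) → List Ω) := fun b =>
    (fun j => b j, exitTable shift (fun j : Fin K => b j)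
        ((List.range n).map fun i => b (i + K))) with hΦ
  have hinj : Set.InjOn Φ (periodicSequences Ω n (K + 1) m) := by
    intro b hb b' hb' h
    simp only [hΦ, Prod.mk.injEq] at h
    obtain ⟨h1, h2⟩ := h
    rw [h1] at h2
    have h3 := exitTable_injective _ _ h2
    have h4 : ∀ i, b (i + K) = b' (i + K) := by
      intro i
      have hb1 : Function.Periodic (fun i => b (i + K)) n := fun i => by
        simp only [Nat.add_right_comm i n]; exact hb.1 _
      have hb2 : Function.Periodic (fun i => b' (i + K)) n := fun i => by
        simp only [Nat.add_right_comm i n]; exact hb'.1 _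
      rw [← hb1.map_mod_nat i, ← hb2.map_mod_nat i]
      exact List.map_inj_left.mp h3 _ (List.mem_range.mpr (Nat.mod_lt _ hn0))
    ext i
    rw [← hb.1.nat_mul K i, ← hb'.1.nat_mul K i]
    have := h4 (i + (K * n - K))
    rwa [show i + (K * n - K) + K = i + K * n by omega] at this
  rw [← hinj.ncard_image]
  congr 1
  refine Set.Subset.antisymm ?_ ?_
  · rintro _ ⟨b, hb, rfl⟩
    have hU := (mem_periodicSequences_iff_isUniform.mp hb).2
    rw [Finset.mem_coe, mem_rootedTables]
    exact ⟨hU, (exists_exitTable_iff (hU.isBalanced _)).mp ⟨_, rfl⟩⟩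
  · rintro ⟨u, T⟩ hT
    rw [Finset.mem_coe, mem_rootedTables] at hT
    obtain ⟨hU, hL⟩ := hT
    simp only at hU hL
    obtain ⟨s, rfl⟩ := (exists_exitTable_iff (hU.isBalanced u)).mpr hL
    have hlen : s.length = n := by
      rw [← sum_length_exitTable shift u s, Finset.sum_congr rfl fun v _ => hU.length v, hn]
      simp
      ring
    obtain ⟨a₀⟩ : Nonempty Ω := inferInstance
    set x : ℕ → Ω := fun i => s.getD (i % n) a₀ with hx
    have hxper : Function.Periodic x n := fun i => by simp [hx]
    have hs : (List.range n).map x = s := by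
      refine List.ext_getElem (by simp [hlen]) fun i h1 h2 => ?_
      have hi : i % n = i := Nat.mod_eq_of_lt (hlen ▸ h2)
      simp [hx, hi, h2]
    -- The table is balanced both from u to the end of the walk and from u to u; comparing the two
    -- conditions at u makes the walk closed.
    have hclosed : walk shift u x n = u := by
      rw [← walk_eq_foldl, hs]
      have h1 := isBalanced_exitTable shift u s u
      have h2 := hU.isBalanced u u
      by_contra hne
      simp only [if_true, if_neg (Ne.symm hne)] at h1 h2
      omega
    have hwper := walk_add_of_periodic hxper hclosed
    have hstart : (fun j : Fin K => x (j + (K * n - K))) = u := by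
      have h0 : walk shift u x (K * n) = u := by
        have := hwper.nat_mul K 0
        simpa [walk] using this
      ext1 j
      conv_rhs => rw [← h0]
      have := j.isLt
      rw [walk_shift_apply, dif_neg (by omega)]
      congr 1
      omega
    have hread : (fun i => x (i + K + (K * n - K))) = x := by
      ext1 i
      rw [show i + K + (K * n - K) = i + K * n by omega]
      exact hxper.nat_mul K i
    have hΦb : Φ (fun i => x (i + (K * n - K))) = (u, exitTable shift u s) := by
      simp only [hΦ, hstart, hread, hs]
    refine ⟨fun i => x (i + (K * n - K)), ?_, hΦb⟩
    rw [mem_periodicSequences_iff_isUniform]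
    refine ⟨fun i => ?_, ?_⟩
    · simp only
      rw [Nat.add_right_comm]
      exact hxper _
    · have := congrArg Prod.snd hΦb
      simp only [hΦ] at this
      rw [this]
      exact hU

end PeriodicSequences


/-! ### Counting over periods, and gcds -/

section PeriodicCount

variable {p : ℕ → Prop} [DecidablePred p]

theorem count_shift_of_periodic {n : ℕ} (hp : Function.Periodic p n) (c : ℕ) :
    Nat.count (fun i => p (i + c)) n = Nat.count p n := by
  have h1 := Nat.count_add p c n
  have h2 := Nat.count_add p n c
  have h3 : Nat.count (fun i => p (n + i)) c = Nat.count p c := by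
    congr 1
    ext i
    rw [add_comm, hp]
  have h4 : Nat.count (fun i => p (c + i)) n = Nat.count (fun i => p (i + c)) n := by
    congr 1
    ext i
    rw [add_comm]
  rw [add_comm n c] at h2
  omega

theorem count_mul_of_periodic {d : ℕ} (hp : Function.Periodic p d) (e : ℕ) :
    Nat.count p (e * d) = e * Nat.count p d := by
  induction e with
  | zero => simp
  | succ e ih =>
    have h : Nat.count (fun i => p (e * d + i)) d = Nat.count p d := by
      congr 1
      ext i
      rw [add_comm, ← smul_eq_mul, hp.nsmul e i]
    rw [Nat.succ_mul, Nat.count_add, ih, h, Nat.succ_mul]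

end PeriodicCount

theorem periodic_gcd {α : Type*} {b : ℕ → α} {n g : ℕ} (hn : Function.Periodic b n)
    (hg : Function.Periodic b g) : Function.Periodic b (n.gcd g) := by
  rcases Nat.eq_zero_or_pos n with rfl | hpos
  · simpa using hg
  -- Bézout is used as g t ≡ gcd modulo n with the gcd as a remainder, which requires it to be less
  -- than n.
  rcases (Nat.gcd_le_left g hpos).eq_or_lt with h | h
  · rwa [h]
  · obtain ⟨t, -, ht⟩ := Nat.exists_mul_mod_eq_gcd (n := g) (k := n) (by rwa [Nat.gcd_comm])
    intro i
    have h1 := hn.nsmul (g * t / n) (i + g * t % n)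
    have h2 := hg.nsmul t i
    rw [smul_eq_mul, add_assoc, Nat.mod_add_div', mul_comm g, ← smul_eq_mul, h2] at h1
    rw [Nat.gcd_comm, ← ht, mul_comm g, h1, smul_eq_mul]

theorem sum_zmod_val {n : ℕ} [NeZero n] (f : ℕ → ℕ) :
    ∑ g : ZMod n, f g.val = ∑ i ∈ Finset.range n, f i := by
  rcases n with _ | n
  · exact absurd rfl (NeZero.ne 0)
  · exact Fin.sum_univ_eq_sum_range f (n + 1)

/-- Exactly φ(n/d) of the residues have gcd d with n; the sum is indexed by e = n/d. -/
theorem sum_range_gcd {n : ℕ} (hn : 0 < n) (f : ℕ → ℕ) :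
    ∑ i ∈ Finset.range n, f (n.gcd i) = ∑ e ∈ n.divisors, e.totient * f (n / e) := by
  rw [← Nat.sum_div_divisors n fun e => e.totient * f (n / e),
    ← Finset.sum_fiberwise_of_maps_to (s := Finset.range n) (t := n.divisors) (g := n.gcd)
      fun i _ => Nat.mem_divisors.mpr ⟨Nat.gcd_dvd_left n i, hn.ne'⟩]
  refine Finset.sum_congr rfl fun d hd => ?_
  have hdn := Nat.dvd_of_mem_divisors hd
  rw [Nat.totient_div_of_dvd hdn, Nat.div_div_self hdn hn.ne',
    Finset.sum_congr rfl fun i hi => by rw [(Finset.mem_filter.mp hi).2]]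
  simp

/-! ### Rotations and their fixed points -/

section Rotations

variable {Ω : Type*} {n k m : ℕ}

theorem periodic_occurs {b : ℕ → Ω} (hb : Function.Periodic b n) (y : Fin k → Ω) :
    Function.Periodic (fun i => ∀ j : Fin k, b (i + j) = y j) n := fun i => by
  simp only [Nat.add_right_comm i n, hb (i + _)]

theorem rotate_map_range {b : ℕ → Ω} (hb : Function.Periodic b n) (c : ℕ) :
    ((List.range n).map b).rotate c = (List.range n).map fun i => b (i + c) := by
  refine List.ext_getElem (by simp) fun i h1 h2 => ?_
  simp [List.getElem_rotate, hb.map_mod_nat]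

variable [DecidableEq Ω]

theorem shift_mem_periodicSequences {b : ℕ → Ω} (hb : b ∈ periodicSequences Ω n k m) (c : ℕ) :
    (fun i => b (i + c)) ∈ periodicSequences Ω n k m := by
  refine ⟨fun i => ?_, fun y => ?_⟩
  · simp only [Nat.add_right_comm i n, hb.1 (i + c)]
  · rw [← hb.2 y, ← count_shift_of_periodic (periodic_occurs hb.1 y) c]
    simp only [Nat.add_right_comm]

/-- The rotations of periodic sequences. -/
instance [NeZero n] : AddAction (ZMod n) (periodicSequences Ω n k m) where
  vadd g b := ⟨fun i => b.1 (i + g.val), shift_mem_periodicSequences b.2 _⟩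
  zero_vadd b := Subtype.ext (funext fun i => by
    change b.1 (i + (0 : ZMod n).val) = b.1 i
    rw [ZMod.val_zero, add_zero])
  add_vadd g h b := Subtype.ext (funext fun i => by
    change b.1 (i + (g + h).val) = b.1 (i + g.val + h.val)
    rw [← b.2.1.map_mod_nat, ← b.2.1.map_mod_nat (i + g.val + h.val), ZMod.val_add,
      Nat.add_mod_mod, add_assoc])

theorem vadd_apply [NeZero n] (g : ZMod n) (b : periodicSequences Ω n k m) (i : ℕ) :
    (g +ᵥ b).1 i = b.1 (i + g.val) := rfl

/-- A sequence of periods n and g has period d = gcd(n, g), so a window of length n is n/d copies of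
one of length d and all counts scale by n/d. -/
theorem periodicSequences_inter_periodic (g : ℕ) :
    {b | b ∈ periodicSequences Ω n k m ∧ Function.Periodic b g} =
      {b | Function.Periodic b (n.gcd g) ∧ ∀ y : Fin k → Ω,
        n / n.gcd g * Nat.count (fun i => ∀ j : Fin k, b (i + j) = y j) (n.gcd g) = m} := by
  have hd : n / n.gcd g * n.gcd g = n := Nat.div_mul_cancel (Nat.gcd_dvd_left n g)
  ext b
  constructor
  · rintro ⟨hb, hg⟩
    have hper := periodic_gcd hb.1 hg
    refine ⟨hper, fun y => ?_⟩
    rw [← count_mul_of_periodic (periodic_occurs hper y), hd]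
    exact hb.2 y
  · rintro ⟨hper, hc⟩
    have hmul : ∀ t, n.gcd g ∣ t → Function.Periodic b t := by
      rintro _ ⟨c, rfl⟩ i
      rw [mul_comm]
      exact hper.nat_mul c i
    refine ⟨⟨hmul n (Nat.gcd_dvd_left n g), fun y => ?_⟩, hmul g (Nat.gcd_dvd_right n g)⟩
    rw [← hc y, ← count_mul_of_periodic (periodic_occurs hper y), hd]

theorem ncard_periodicSequences_inter_periodic [Nonempty Ω] (hn : 0 < n) (g : ℕ) :
    {b | b ∈ periodicSequences Ω n k m ∧ Function.Periodic b g}.ncard =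
      if n / n.gcd g ∣ m then (periodicSequences Ω (n.gcd g) k (m / (n / n.gcd g))).ncard
      else 0 := by
  rw [periodicSequences_inter_periodic]
  have he : 0 < n / n.gcd g :=
    Nat.div_pos (Nat.gcd_le_left g hn) (Nat.gcd_pos_of_pos_left g hn)
  split_ifs with h
  · congr 1
    ext b
    refine and_congr_right fun _ => forall_congr' fun y => ?_
    rw [mul_comm, Nat.eq_div_iff_mul_eq_left he.ne' h, eq_comm]
  · obtain ⟨a⟩ : Nonempty Ω := inferInstance
    refine (congrArg Set.ncard (Set.eq_empty_of_forall_notMem ?_)).trans (Set.ncard_empty _)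
    rintro b ⟨-, hb⟩
    exact h ⟨_, (hb fun _ => a).symm⟩

end Rotations

/-! ### Cyclic sequences as orbits of periodic sequences -/

section Cycles

variable {Ω : Type*} [DecidableEq Ω] {n k m : ℕ}

theorem listOccurrences_map_range (hn : 0 < n) {b : ℕ → Ω} (hb : Function.Periodic b n)
    (y : Fin k → Ω) : listOccurrences y ((List.range n).map b) =
      Nat.count (fun i => ∀ j : Fin k, b (i + j) = y j) n := by
  rw [listOccurrences, Nat.count_eq_card_filter_range]
  simp [Nat.mod_lt _ hn, hb.map_mod_nat]

/-- The cyclic sequence of a period of a periodic sequence. -/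
def toCycle (b : periodicSequences Ω n k m) : Cycle Ω := ((List.range n).map b.1 : List Ω)

theorem toCycle_eq_iff [NeZero n] (b b' : periodicSequences Ω n k m) :
    toCycle b = toCycle b' ↔ AddAction.orbitRel (ZMod n) (periodicSequences Ω n k m) b b' := by
  have hn : 0 < n := NeZero.pos n
  rw [AddAction.orbitRel_apply, eq_comm, toCycle, toCycle, Cycle.coe_eq_coe]
  constructor
  · rintro ⟨c, hc⟩
    refine ⟨(c : ZMod n), Subtype.ext (funext fun i => ?_)⟩
    simp only
    rw [vadd_apply, ZMod.val_natCast, ← b'.2.1.map_mod_nat, Nat.add_mod_mod,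
      ← b.2.1.map_mod_nat i, b'.2.1.map_mod_nat]
    rw [rotate_map_range b'.2.1] at hc
    rw [← List.map_inj_left.mp hc _ (List.mem_range.mpr (Nat.mod_lt _ hn)),
      ← b'.2.1.map_mod_nat (i % n + c), Nat.mod_add_mod, b'.2.1.map_mod_nat]
  · rintro ⟨g, rfl⟩
    exact ⟨g.val, rotate_map_range b'.2.1 _⟩

/-- Each position carries exactly one k-mer. This forces the length m q^k on cyclic multi de Bruijn
sequences. -/
theorem sum_count_kmer [Fintype Ω] (b : ℕ → Ω) (n : ℕ) :
    ∑ y : Fin k → Ω, Nat.count (fun i => ∀ j : Fin k, b (i + j) = y j) n = n := by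
  induction n with
  | zero => simp
  | succ n ih =>
    simp only [Nat.count_succ, Finset.sum_add_distrib, ih]
    simp [← funext_iff]

theorem range_toCycle [Fintype Ω] [Nonempty Ω] (hm : 1 ≤ m) :
    Set.range (toCycle (Ω := Ω) (n := m * Fintype.card Ω ^ k) (k := k) (m := m)) =
      cyclicMultiDeBruijn Ω m k := by
  refine Set.Subset.antisymm ?_ ?_
  · rintro _ ⟨b, rfl⟩ y
    have hn : 0 < m * Fintype.card Ω ^ k := Nat.mul_pos hm (pow_pos Fintype.card_pos _)
    exact (listOccurrences_map_range hn b.2.1 y).trans (b.2.2 y)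
  · intro c
    induction c using Quotient.inductionOn with
    | _ s =>
    intro hs
    replace hs : ∀ y : Fin k → Ω, listOccurrences y s = m := hs
    obtain ⟨a₀⟩ : Nonempty Ω := inferInstance
    have hlen : 0 < s.length := by
      by_contra h0
      have := hs fun _ => a₀
      simp [listOccurrences, List.length_eq_zero_iff.mp (Nat.eq_zero_of_not_pos h0)] at this
      omega
    set b : ℕ → Ω := fun i => s.getD (i % s.length) a₀ with hb
    have hper : Function.Periodic b s.length := fun i => by simp [hb]
    have hbs : (List.range s.length).map b = s := by
      refine List.ext_getElem (by simp) fun i h1 h2 => ?_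
      simp [hb, Nat.mod_eq_of_lt h2, h2]
    have hcount : ∀ y : Fin k → Ω,
        Nat.count (fun i => ∀ j : Fin k, b (i + j) = y j) s.length = m := fun y => by
      rw [← listOccurrences_map_range hlen hper, hbs, hs]
    have hn : s.length = m * Fintype.card Ω ^ k := by
      rw [← sum_count_kmer (k := k) b s.length, Finset.sum_congr rfl fun y _ => hcount y]
      simp [mul_comm]
    rw [hn] at hper hcount
    refine ⟨⟨b, hper, hcount⟩, ?_⟩
    change (((List.range (m * Fintype.card Ω ^ k)).map b : List Ω) : Cycle Ω) = _
    rw [← hn, hbs]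
    rfl

end Cycles

/-! ### The Burnside count -/

section Count

variable {Ω : Type*} [Fintype Ω] [DecidableEq Ω]

theorem W_eq_card_wordsWithCounts (r K : ℕ) :
    W r (Fintype.card Ω) (K + 1) =
      ((wordsWithCounts fun _ : Ω => r).card : ℚ) ^ Fintype.card Ω ^ K := by
  rw [W, Nat.add_sub_cancel]
  congr 1
  have h := card_wordsWithCounts fun _ : Ω => r
  simp only [Finset.prod_const, Finset.sum_const, Finset.card_univ, smul_eq_mul] at h
  rw [mul_comm r, ← h, div_eq_iff (pow_ne_zero _ (Nat.cast_ne_zero.mpr r.factorial_ne_zero))]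
  push_cast
  rfl

variable [Nonempty Ω]

theorem ncard_cyclicMultiDeBruijn_mul {m K : ℕ} (hm : 1 ≤ m) :
    (cyclicMultiDeBruijn Ω m (K + 1)).ncard * (m * Fintype.card Ω ^ (K + 1)) =
      ∑ r ∈ m.divisors,
        (m / r).totient * (wordsWithCounts fun _ : Ω => r).card ^ Fintype.card Ω ^ K := by
  classical
  set n := m * Fintype.card Ω ^ (K + 1) with hn
  have hn0 : 0 < n := Nat.mul_pos hm (pow_pos Fintype.card_pos _)
  have : NeZero n := ⟨hn0.ne'⟩
  have : Fintype (periodicSequences Ω n (K + 1) m) :=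
    (finite_periodicSequences hn0 (K + 1) m).fintype
  have hker : Setoid.ker (toCycle (Ω := Ω) (n := n) (k := K + 1) (m := m)) =
      AddAction.orbitRel (ZMod n) (periodicSequences Ω n (K + 1) m) :=
    Setoid.ext fun b b' => toCycle_eq_iff b b'
  have horb : (cyclicMultiDeBruijn Ω m (K + 1)).ncard = Fintype.card
      (Quotient (AddAction.orbitRel (ZMod n) (periodicSequences Ω n (K + 1) m))) := by
    rw [← range_toCycle hm, ← Nat.card_coe_set_eq, ← Nat.card_congr (Setoid.quotientKerEquivRange _),
      hker, Nat.card_eq_fintype_card]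
  have hB := AddAction.sum_card_fixedBy_eq_card_orbits_mul_card_addGroup (ZMod n)
    (periodicSequences Ω n (K + 1) m)
  rw [ZMod.card, ← horb] at hB
  rw [← hB]
  -- The number of sequences fixed by a rotation g depends only on d = gcd(n, g); `c d` is its
  -- value.
  set c : ℕ → ℕ := fun d => if n / d ∣ m then
    (wordsWithCounts fun _ : Ω => m / (n / d)).card ^ Fintype.card Ω ^ K else 0 with hc
  have hfix : ∀ g : ZMod n,
      Fintype.card (AddAction.fixedBy (periodicSequences Ω n (K + 1) m) g) = c (n.gcd g.val) := by
    intro g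
    have h1 : Fintype.card (AddAction.fixedBy (periodicSequences Ω n (K + 1) m) g) =
        {b | b ∈ periodicSequences Ω n (K + 1) m ∧ Function.Periodic b g.val}.ncard := by
      rw [← Nat.card_eq_fintype_card, Nat.card_coe_set_eq,
        ← Set.ncard_image_of_injective _ Subtype.val_injective]
      congr 1
      ext b
      constructor
      · rintro ⟨b, hb, rfl⟩
        exact ⟨b.2, fun i => congrFun (congrArg Subtype.val hb) i⟩
      · rintro ⟨hb, hg⟩
        exact ⟨⟨b, hb⟩, Subtype.ext (funext hg), rfl⟩
    rw [h1, ncard_periodicSequences_inter_periodic hn0, hc]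
    simp only
    split_ifs with h
    · have he : 0 < n / n.gcd g.val :=
        Nat.div_pos (Nat.gcd_le_left _ hn0) (Nat.gcd_pos_of_pos_left _ hn0)
      -- The common period d is exactly the length required for multiplicity m/e with e = n/d.
      have hd : n.gcd g.val = m / (n / n.gcd g.val) * Fintype.card Ω ^ (K + 1) := by
        refine Nat.eq_of_mul_eq_mul_left he ?_
        rw [Nat.div_mul_cancel (Nat.gcd_dvd_left _ _), ← mul_assoc, Nat.mul_div_cancel' h]
      have h2 := ncard_periodicSequences (Ω := Ω) (K := K) (m := m / (n / n.gcd g.val))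
        (Nat.div_pos (Nat.le_of_dvd hm h) he)
      rwa [← hd] at h2
    · rfl
  rw [Finset.sum_congr rfl fun g _ => hfix g, sum_zmod_val fun i => c (n.gcd i),
    sum_range_gcd hn0, ← Nat.sum_div_divisors m fun r => (m / r).totient *
      (wordsWithCounts fun _ : Ω => r).card ^ Fintype.card Ω ^ K]
  symm
  have hmn : m ∣ n := Dvd.intro _ rfl
  -- Divisors e of n not dividing m contribute 0; for e ∣ m the term is the one with r = m/e.
  refine Finset.sum_subset_zero_on_sdiff (Nat.divisors_subset_of_dvd hn0.ne' hmn) ?_ ?_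
  · intro e he
    rw [Finset.mem_sdiff, Nat.mem_divisors, Nat.mem_divisors] at he
    have : ¬ e ∣ m := fun h => he.2 ⟨h, by omega⟩
    simp [hc, Nat.div_div_self he.1.1 hn0.ne', this]
  · intro e he
    have he := Nat.dvd_of_mem_divisors he
    rw [hc]
    simp only [Nat.div_div_self (he.trans hmn) hn0.ne', he, if_true]
    rw [Nat.div_div_self he (by omega)]

end Count

end MultiDeBruijn

theorem mainTheorem1 {Ω : Type*} [Fintype Ω] [DecidableEq Ω] (m q k : ℕ)
    (hm : 1 ≤ m) (hq : 1 ≤ q) (hk : 1 ≤ k) (hΩ : Fintype.card Ω = q) :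
    (MultiDeBruijn.cyclicMultiDeBruijn Ω m k).Finite ∧
      ((MultiDeBruijn.cyclicMultiDeBruijn Ω m k).ncard : ℚ) =
        1 / ((m : ℚ) * (q : ℚ) ^ k) *
          ∑ r ∈ m.divisors, (Nat.totient (m / r) : ℚ) * MultiDeBruijn.W r q k := by
  subst hΩ
  have : Nonempty Ω := Fintype.card_pos_iff.mp hq
  obtain ⟨K, rfl⟩ : ∃ K, k = K + 1 := ⟨k - 1, by omega⟩
  have hn : 0 < m * Fintype.card Ω ^ (K + 1) := Nat.mul_pos hm (pow_pos hq _)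
  refine ⟨?_, ?_⟩
  · rw [← MultiDeBruijn.range_toCycle hm]
    have := (MultiDeBruijn.finite_periodicSequences (Ω := Ω) hn (K + 1) m).to_subtype
    exact Set.finite_range _
  · have h := MultiDeBruijn.ncard_cyclicMultiDeBruijn_mul (Ω := Ω) (K := K) hm
    have hne : ((m : ℚ) * (Fintype.card Ω : ℚ) ^ (K + 1)) ≠ 0 := by exact_mod_cast hn.ne'
    rw [one_div, eq_inv_mul_iff_mul_eq₀ hne, mul_comm]
    simp only [MultiDeBruijn.W_eq_card_wordsWithCounts]
    exact_mod_cast h
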